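/- Let $Y$ be a finite set and let $G\in\mathbb R^{Y\times Y}$ satisfy $G_{ji}\ge 0$ for $j\ne i$ and $\sum_{j\in Y}G_{ji}\le 0$ for every $i\in Y$ ($G_{ji}$ is the jump rate from $i$ to $j$). Let $\omega\notin Y$ be a cemetery state and let $G_{\omega i}:=-\sum_{j\in Y}G_{ji}\ge 0$ be the termination rate from $i$. A (possibly leaky) Markov jump process with generator $G$ is a process $(Z^t)_{t\ge 0}$ with values in $Y\cup\{\omega\}$ such that $\mathbb P(Z^{s+t}=j\mid Z^s=i)=(e^{tG})_{ji}$ for all $i,j\in Y$, $s,t\ge 0$ (whenever $\mathbb P(Z^s=i)>0$), which almost surely stays in $\omega$ once it is there and almost surely has right-continuous paths (for the discrete topology). Let $T\subseteq Y$ be absorbing, i.e. $\sum_{j\in T}(e^{tG})_{ji}=1$ for all $i\in T$, $t\ge 0$, put $\widehat G:=G_{Y\setminus T,\,Y\setminus T}$, and assume $\lim_{t\to\infty}e^{t\widehat G}=0$. For $i\in Y\cup\{\omega\}$ let $a_i:=\mathbb E(A\mid Z^0=i)\in[0,\infty]$, where $A:=\inf\{t\ge 0: Z^t\in T\}$ ($\inf\emptyset=\infty$),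 be the expected absorption time, computed from any Markov jump process with generator $G$ such that $\mathbb P(Z^0=i)>0$ (possibly a different process for different $i$). Consider, for vectors $a=(a_i)_{i\in Y\cup\{\omega\}}$ with entries in $(-\infty,\infty]$, the linear system $$\sum_{j\in (Y\setminus T)\cup\{\omega\}} a_jG_{ji}=-1\quad (i\in Y\setminus T),\qquad a_i=0\quad(i\in T),\qquad a_\omega=\infty,$$ where the first line is read, to avoid $\infty-\infty$, as $\sum_{j\in (Y\setminus T)\cup\{\omega\},\,j\neq i}a_jG_{ji}+1=-G_{ii}\,a_i$ with $0\cdot\infty=0$. Then the vector of expected absorption times is the unique solution of this system among the vectors that take the value $\infty$ only where this is forced by $a_\omega=\infty$, that is, only at $\omega$ and at states $i\in Y$ from which the process terminates with positive probability ($\sum_{j\in Y}(e^{tG})_{ji}<1$ for some $t\ge0$). Moreover, every solution with entries in $(-\infty,\infty]$ agrees with the vector of expected absorption times at each state where it is finite. -/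

import Mathlib

open Filter Topology MeasureTheory ProbabilityTheory
open scoped NNReal ENNReal

noncomputable section

namespace JumpProcess

variable {Y : Type*} [Fintype Y] [DecidableEq Y]

/-- `G` is the generator of a (possibly leaky) Markov jump process on the finite set `Y`.
`G j i` is the rate of jumping from `i` to `j`, so it is the column sums that are nonpositive. -/
structure IsGenerator (G : Matrix Y Y ℝ) : Prop where
  off_diag_nonneg : ∀ i j, i ≠ j → 0 ≤ G i j
  col_sum_nonpos : ∀ j, ∑ i, G i j ≤ 0

/-- The sub-stochastic transition matrix `P^t = e^{tG}`; the entry `(j, i)` is the probability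
of going from `i` to `j` in time `t`. -/
def transition (G : Matrix Y Y ℝ) (t : ℝ≥0) : Matrix Y Y ℝ :=
  NormedSpace.exp ((t : ℝ) • G)

/-- The termination rate `G_{ω i}` from the state `i`. -/
def terminationRate (G : Matrix Y Y ℝ) (i : Y) : ℝ := -∑ j, G j i

/-- The block `Ĝ` of the jump rates from `Y ∖ T` to `Y ∖ T`. -/
def restrictedGenerator (G : Matrix Y Y ℝ) (T : Finset Y) :
    Matrix {i // i ∉ T} {i // i ∉ T} ℝ :=
  G.submatrix Subtype.val Subtype.val

/-- `T` is absorbing: started in `T`, the process is in `T` at every time `t` with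
probability one. -/
def IsAbsorbing (G : Matrix Y Y ℝ) (T : Finset Y) : Prop :=
  ∀ t : ℝ≥0, ∀ i ∈ T, ∑ j ∈ T, transition G t j i = 1

/-- With positive probability a process with generator `G` that starts in the given state has
terminated at some time. The state `none` is the cemetery `ω`. -/
def CanTerminate (G : Matrix Y Y ℝ) : Option Y → Prop
  | none => True
  | some i => ∃ t : ℝ≥0, ∑ j, transition G t j i < 1

/-- `Z` is a (possibly leaky) Markov jump process with generator `G` under `P`. The value
`Z t x = none` means that the process has already terminated (`Z^t = ω`).

The field `transition_prob` is `P(Z^{s+t} = j | Z^s = i) = (e^{tG})_{ji}`, multiplied by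
`P(Z^s = i)`, which need not be positive. Conditioning on the whole past up to time `s` is not
required, so every process that has the Markov property in that stronger form, with these
transition probabilities, is included. Almost every path is right-continuous for the discrete
topology (the process stays for a positive time in the state it has entered). -/
structure IsMarkovJumpProcess {Ω : Type*} [MeasurableSpace Ω] (G : Matrix Y Y ℝ)
    (P : Measure Ω) (Z : ℝ≥0 → Ω → Option Y) : Prop where
  measurable : ∀ t i, MeasurableSet (Z t ⁻¹' {i})
  transition_prob : ∀ (s t : ℝ≥0) (i j : Y),
    P.real (Z s ⁻¹' {some i} ∩ Z (s + t) ⁻¹' {some j}) =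
      transition G t j i * P.real (Z s ⁻¹' {some i})
  terminated : ∀ᵐ x ∂P, ∀ s t : ℝ≥0, s ≤ t → Z s x = none → Z t x = none
  right_continuous : ∀ᵐ x ∂P, ∀ t : ℝ≥0, ∀ᶠ s in 𝓝[>] t, Z s x = Z t x

/-- The absorption time `A = inf {t | Z^t ∈ T}`, equal to `∞` if `T` is never entered. -/
def absorptionTime {Ω : Type*} (T : Finset Y) (Z : ℝ≥0 → Ω → Option Y) (x : Ω) : ℝ≥0∞ :=
  ⨅ (t : ℝ≥0) (_ : ∃ j ∈ T, Z t x = some j), (t : ℝ≥0∞)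

/-- The expected absorption time `E(A | Z^0 = i)`, for `i` in `Y ∪ {ω}`. -/
def expectedAbsorptionTime {Ω : Type*} [MeasurableSpace Ω] (T : Finset Y) (P : Measure Ω)
    (Z : ℝ≥0 → Ω → Option Y) (i : Option Y) : ℝ≥0∞ :=
  ∫⁻ x, absorptionTime T Z x ∂(P[|Z 0 ⁻¹' {i}])

/-- `a`, with values in `(-∞, ∞]`, solves the linear system
`∑_{j ∈ (Y ∖ T) ∪ {ω}} a_j G_{ji} = -1` for `i ∈ Y ∖ T`, `a_i = 0` for `i ∈ T`, `a_ω = ∞`.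

In order not to meet `∞ - ∞`, the term `j = i`, the only one with a nonpositive coefficient, is
brought to the other side: `∑_{j ≠ i} a_j G_{ji} + 1 = -G_{ii} a_i`, where `0 * ∞ = 0`. -/
structure SolvesSystem (G : Matrix Y Y ℝ) (T : Finset Y) (a : Option Y → EReal) : Prop where
  ne_bot : ∀ i, a i ≠ ⊥
  off_target : ∀ i ∉ T,
    (∑ j ∈ Tᶜ.erase i, a (some j) * (G j i : EReal)) +
        a none * (terminationRate G i : EReal) + 1 =
      ((-G i i : ℝ) : EReal) * a (some i)
  target : ∀ i ∈ T, a (some i) = 0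
  cemetery : a none = ⊤

end JumpProcess

end

/-! Write Ĝ for the block of `G` off `T`. If v Ĝ = 0 on a set of states that Ĝ does not leave, then
e^{tĜ} fixes v there, and e^{tĜ} → 0 forces v = 0 there (`eq_zero_of_vecMul_eq_zero_of_closed`). In
particular Ĝ is invertible, and w Ĝ = -1 has a solution w.

Probability enters through E A = ∫ P(A > t) dt. From a state i off `T` that cannot terminate, P(A >
t) is a column sum of e^{tĜ}, which has the antiderivative -(w e^{tĜ})_i, so E A = w_i. From a state
that can terminate, A = ∞ with positive probability.

Conversely, where a solution is finite, its equation forbids termination and jumps to states of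
value ∞. The finite states are therefore closed: none of them can terminate, and off `T` the
solution equals w on them. Infinite values can sustain one another around a cycle of jumps, so
uniqueness needs the restriction on where they occur. -/

namespace JumpProcess

/-! ### Matrix exponentials and closed sets of states. -/

open Matrix in
-- The relation passes to powers and so to the exponential series. `M` is rectangular so that it can
-- be a matrix selecting rows or columns.
theorem exp_smul_mul_of_intertwines {m n : Type*} [Fintype m] [DecidableEq m] [Fintype n]
    [DecidableEq n] {A : Matrix m m ℝ} {M : Matrix m n ℝ} {B : Matrix n n ℝ}
    (h : A * M = M * B) (t : ℝ) :
    NormedSpace.exp (t • A) * M = M * NormedSpace.exp (t • B) := by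
  have hpow : ∀ k : ℕ, (t • A) ^ k * M = M * (t • B) ^ k := by
    intro k
    induction k with
    | zero => simp
    | succ k ih =>
      rw [pow_succ, Matrix.mul_assoc, Matrix.smul_mul, h, ← Matrix.mul_smul, ← Matrix.mul_assoc,
        ih, Matrix.mul_assoc, ← pow_succ]
  open scoped Norms.Operator in
  have hA := NormedSpace.exp_series_hasSum_exp' (𝕂 := ℝ) (t • A)
  open scoped Norms.Operator in
  have hB := NormedSpace.exp_series_hasSum_exp' (𝕂 := ℝ) (t • B)
  have hA' := hA.map (AddMonoidHom.mk' (fun X : Matrix m m ℝ => X * M)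
    fun X X' => Matrix.add_mul X X' M) (by
      show Continuous fun X : Matrix m m ℝ => X * M
      fun_prop)
  have hB' := hB.map (AddMonoidHom.mk' (fun X : Matrix n n ℝ => M * X)
    fun X X' => Matrix.mul_add M X X') (by
      show Continuous fun X : Matrix n n ℝ => M * X
      fun_prop)
  refine hA'.unique ?_
  have hfun : (AddMonoidHom.mk' (fun X : Matrix m m ℝ => X * M) fun X X' =>
      Matrix.add_mul X X' M) ∘ (fun k : ℕ => ((k.factorial : ℝ))⁻¹ • (t • A) ^ k) =
      (AddMonoidHom.mk' (fun X : Matrix n n ℝ => M * X) fun X X' =>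
      Matrix.mul_add M X X') ∘ (fun k : ℕ => ((k.factorial : ℝ))⁻¹ • (t • B) ^ k) := by
    funext k
    simp [hpow]
  rw [hfun]
  exact hB'

/-- If the rows of `M` in `p` vanish outside `p`, the exponential restricted to `p` is the exponential of the restriction. -/
theorem exp_smul_submatrix_of_rows {Y : Type*} [Fintype Y] [DecidableEq Y] (M : Matrix Y Y ℝ)
    (p : Y → Prop) [DecidablePred p] (h : ∀ j i, p j → ¬ p i → M j i = 0) (t : ℝ)
    (j i : {i // p i}) :
    NormedSpace.exp (t • M) j i =
      NormedSpace.exp (t • M.submatrix (Subtype.val : {i // p i} → Y) Subtype.val) j i := by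
  -- `R` selects the rows in `p`; the hypothesis `h` says that `R` intertwines the block with `M`.
  let R : Matrix {i // p i} Y ℝ := (1 : Matrix Y Y ℝ).submatrix Subtype.val id
  have hR : ∀ (X : Matrix Y Y ℝ), R * X = X.submatrix Subtype.val id := by
    intro X
    ext j i
    simp [R, Matrix.mul_apply, Matrix.one_apply]
  have key := exp_smul_mul_of_intertwines
    (A := M.submatrix (Subtype.val : {i // p i} → Y) Subtype.val) (M := R) (B := M) (by
      rw [hR]
      ext j i
      by_cases hi : p i
      · simp only [R, Matrix.mul_apply, Matrix.submatrix_apply, Matrix.one_apply, id]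
        rw [Finset.sum_eq_single ⟨i, hi⟩] <;> simp +contextual [Subtype.ext_iff]
      · simp only [R, Matrix.mul_apply, Matrix.submatrix_apply, Matrix.one_apply, id]
        rw [h j i j.2 hi]
        refine Finset.sum_eq_zero fun k _ => ?_
        have : (k : Y) ≠ i := fun e => hi (e ▸ k.2)
        simp [this]) t
  have := congrFun (congrFun key j) i
  rw [hR] at this
  simp only [Matrix.submatrix_apply, id] at this
  rw [← this]
  simp only [R, Matrix.mul_apply, Matrix.submatrix_apply, Matrix.one_apply, id]
  rw [Finset.sum_eq_single i] <;> simp +contextual [Subtype.ext_iff]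

open Matrix in
/-- If `v M` vanishes on a set `p` of columns which is closed under `M`, then `v e^{tM} = v`
there. -/
theorem vecMul_exp_smul_of_closed {Y : Type*} [Fintype Y] [DecidableEq Y] (M : Matrix Y Y ℝ)
    (p : Y → Prop) (h : ∀ j i, ¬ p j → p i → M j i = 0) (v : Y → ℝ)
    (hv : ∀ i, p i → (v ᵥ* M) i = 0) (t : ℝ) (i : Y) (hi : p i) :
    (v ᵥ* NormedSpace.exp (t • M)) i = v i := by
  classical
  let C : Matrix Y {i // p i} ℝ := (1 : Matrix Y Y ℝ).submatrix id Subtype.val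
  have hC : ∀ X : Matrix Unit Y ℝ, X * C = X.submatrix id Subtype.val := by
    intro X
    ext j i
    simp [C, Matrix.mul_apply, Matrix.one_apply]
  have hC' : ∀ (X : Matrix Y Y ℝ), X * C = X.submatrix id Subtype.val := by
    intro X
    ext j i
    simp [C, Matrix.mul_apply, Matrix.one_apply]
  let B : Matrix {i // p i} {i // p i} ℝ := M.submatrix Subtype.val Subtype.val
  have hMC : M * C = C * B := by
    rw [hC']
    ext j i
    simp only [C, B, Matrix.mul_apply, Matrix.submatrix_apply, Matrix.one_apply, id]
    by_cases hj : p j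
    · rw [Finset.sum_eq_single ⟨j, hj⟩] <;> simp +contextual [Subtype.ext_iff, eq_comm]
    · rw [h j i hj i.2]
      refine (Finset.sum_eq_zero fun k _ => ?_).symm
      have : j ≠ (k : Y) := fun e => hj (e ▸ k.2)
      simp [this]
  -- As v M vanishes on `p`, the row v C intertwines 0 with `B`, and the exponential of 0 is 1.
  have hR : (0 : Matrix Unit Unit ℝ) * (replicateRow Unit v * C) = replicateRow Unit v * C * B := by
    rw [Matrix.zero_mul, Matrix.mul_assoc, ← hMC, ← Matrix.mul_assoc, ← replicateRow_vecMul, hC]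
    ext _ i
    simp [hv i i.2]
  have e1 := exp_smul_mul_of_intertwines hMC t
  have e2 := exp_smul_mul_of_intertwines hR t
  rw [smul_zero, NormedSpace.exp_zero, Matrix.one_mul, Matrix.mul_assoc _ C, ← e1,
    ← Matrix.mul_assoc, hC, hC, ← replicateRow_vecMul] at e2
  have := congrFun (congrFun e2 ()) ⟨i, hi⟩
  simpa using this.symm

open Matrix in
theorem hasDerivAt_vecMul_exp_smul {Y : Type*} [Fintype Y] [DecidableEq Y] (M : Matrix Y Y ℝ)
    (v : Y → ℝ) (i : Y) (t : ℝ) :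
    HasDerivAt (fun s : ℝ => (v ᵥ* NormedSpace.exp (s • M)) i)
      ((v ᵥ* (NormedSpace.exp (t • M) * M)) i) t := by
  open scoped Norms.Operator in
  have h := hasDerivAt_exp_smul_const (𝕂 := ℝ) M t
  have h2 : ∀ j, HasDerivAt (fun s : ℝ => NormedSpace.exp (s • M) j i)
      ((NormedSpace.exp (t • M) * M) j i) t := fun j =>
    (hasDerivAt_pi.1 ((hasDerivAt_pi.1 h) j)) i
  simp only [Matrix.vecMul, dotProduct]
  exact HasDerivAt.fun_sum fun j _ => (h2 j).const_mul (v j)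

open Matrix in
theorem hasDerivAt_vecMul_exp_smul' {Y : Type*} [Fintype Y] [DecidableEq Y] (M : Matrix Y Y ℝ)
    (v : Y → ℝ) (i : Y) (t : ℝ) :
    HasDerivAt (fun s : ℝ => (v ᵥ* NormedSpace.exp (s • M)) i)
      (((v ᵥ* M) ᵥ* NormedSpace.exp (t • M)) i) t := by
  have h : M * M = M * M := rfl
  rw [Matrix.vecMul_vecMul, ← exp_smul_mul_of_intertwines h t]
  exact hasDerivAt_vecMul_exp_smul M v i t

open Matrix in
theorem tendsto_vecMul_exp_smul {Y : Type*} [Fintype Y] [DecidableEq Y] {M : Matrix Y Y ℝ}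
    (hM : Tendsto (fun t : ℝ => NormedSpace.exp (t • M)) atTop (𝓝 0)) (v : Y → ℝ) (i : Y) :
    Tendsto (fun t : ℝ => (v ᵥ* NormedSpace.exp (t • M)) i) atTop (𝓝 0) := by
  have hc : Continuous fun X : Matrix Y Y ℝ => (v ᵥ* X) i := by fun_prop
  have h := (hc.tendsto 0).comp hM
  rw [Matrix.vecMul_zero, Pi.zero_apply] at h
  exact h

open Matrix in
-- The entry of v e^{tM} is constant in t and tends to 0. A general `p` is needed for solutions of
-- the system that are finite only in part.
theorem eq_zero_of_vecMul_eq_zero_of_closed {Y : Type*} [Fintype Y] [DecidableEq Y]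
    {M : Matrix Y Y ℝ} (hM : Tendsto (fun t : ℝ => NormedSpace.exp (t • M)) atTop (𝓝 0))
    (p : Y → Prop) (h : ∀ j i, ¬ p j → p i → M j i = 0) (v : Y → ℝ)
    (hv : ∀ i, p i → (v ᵥ* M) i = 0) (i : Y) (hi : p i) : v i = 0 := by
  have h1 := tendsto_vecMul_exp_smul hM v i
  simp only [vecMul_exp_smul_of_closed M p h v hv _ i hi] at h1
  exact tendsto_nhds_unique tendsto_const_nhds h1

open Matrix in
theorem exists_vecMul_eq_neg_one {Y : Type*} [Fintype Y] [DecidableEq Y] {M : Matrix Y Y ℝ}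
    (hM : Tendsto (fun t : ℝ => NormedSpace.exp (t • M)) atTop (𝓝 0)) :
    ∃ w : Y → ℝ, ∀ i, (w ᵥ* M) i = -1 := by
  have hdet : M.det ≠ 0 := by
    intro h0
    obtain ⟨v, hv, hvM⟩ := Matrix.exists_vecMul_eq_zero_iff.2 h0
    exact hv (funext fun i => eq_zero_of_vecMul_eq_zero_of_closed hM (fun _ => True)
      (by simp) v (by simp [hvM]) i trivial)
  refine ⟨(fun _ => -1) ᵥ* M⁻¹, fun i => ?_⟩
  rw [Matrix.vecMul_vecMul, Matrix.nonsing_inv_mul _ (Ne.isUnit hdet), Matrix.vecMul_one]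

open Matrix in
-- By w M = -1 the column sum is the derivative of -(w e^{tM})_i, which rises from -w_i to 0; its
-- sign gives integrability.
theorem lintegral_sum_exp_smul {Y : Type*} [Fintype Y] [DecidableEq Y] {M : Matrix Y Y ℝ}
    (hM : Tendsto (fun t : ℝ => NormedSpace.exp (t • M)) atTop (𝓝 0)) {w : Y → ℝ}
    (hw : ∀ i, (w ᵥ* M) i = -1) (i : Y)
    (hpos : ∀ t : ℝ, 0 < t → ∀ j, 0 ≤ NormedSpace.exp (t • M) j i) :
    0 ≤ w i ∧ ∫⁻ t in Set.Ioi (0 : ℝ), ENNReal.ofReal (∑ j, NormedSpace.exp (t • M) j i) =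
      ENNReal.ofReal (w i) := by
  have hd : ∀ t : ℝ, HasDerivAt (fun s : ℝ => -(w ᵥ* NormedSpace.exp (s • M)) i)
      (∑ j, NormedSpace.exp (t • M) j i) t := by
    intro t
    have h := (hasDerivAt_vecMul_exp_smul' M w i t).neg
    have e : -((w ᵥ* M) ᵥ* NormedSpace.exp (t • M)) i = ∑ j, NormedSpace.exp (t • M) j i := by
      rw [show w ᵥ* M = fun _ => -1 from funext hw]
      simp [Matrix.vecMul, dotProduct]
    rw [e] at h
    exact h
  have hlim : Tendsto (fun s : ℝ => -(w ᵥ* NormedSpace.exp (s • M)) i) atTop (𝓝 0) := by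
    simpa using (tendsto_vecMul_exp_smul hM w i).neg
  have hnn : ∀ t ∈ Set.Ioi (0 : ℝ), 0 ≤ ∑ j, NormedSpace.exp (t • M) j i :=
    fun t ht => Finset.sum_nonneg fun j _ => hpos t ht j
  have hint := integrableOn_Ioi_deriv_of_nonneg (hd 0).continuousAt.continuousWithinAt
    (fun t _ => hd t) hnn hlim
  have hval := integral_Ioi_of_hasDerivAt_of_nonneg (hd 0).continuousAt.continuousWithinAt
    (fun t _ => hd t) hnn hlim
  have hval' : ∫ t in Set.Ioi (0 : ℝ), ∑ j, NormedSpace.exp (t • M) j i = w i := by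
    rw [hval]; simp
  refine ⟨hval' ▸ setIntegral_nonneg measurableSet_Ioi hnn, ?_⟩
  rw [← hval', ofReal_integral_eq_lintegral_ofReal hint
    ((ae_restrict_iff' measurableSet_Ioi).2 (Eventually.of_forall hnn))]

/-! ### Paths and the law of the absorption time. -/

section
theorem lintegral_Ioi_indicator_lt (a : ℝ≥0∞) :
    ∫⁻ t in Set.Ioi (0 : ℝ), {t : ℝ | ENNReal.ofReal t < a}.indicator 1 t = a := by
  rw [lintegral_indicator_one (measurableSet_lt (by fun_prop) measurable_const),
    Measure.restrict_apply (measurableSet_lt (by fun_prop) measurable_const)]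
  induction a with
  | top => simp
  | coe a =>
    have : {t : ℝ | ENNReal.ofReal t < a} ∩ Set.Ioi 0 = Set.Ioo 0 (a : ℝ) := by
      ext t
      simp only [Set.mem_inter_iff, Set.mem_ofPred_eq, Set.mem_Ioi, Set.mem_Ioo]
      rw [and_comm]
      refine and_congr_right fun ht => ?_
      rw [ENNReal.ofReal_lt_iff_lt_toReal ht.le ENNReal.coe_ne_top, ENNReal.coe_toReal]
    rw [this]
    simp

/-- Layer cake, by Tonelli on the region under the graph; the value ∞ is allowed. -/
theorem lintegral_eq_lintegral_Ioi_measure_lt {Ω : Type*} [MeasurableSpace Ω] (μ : Measure Ω)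
    [SFinite μ] {f : Ω → ℝ≥0∞} (hf : AEMeasurable f μ) :
    ∫⁻ x, f x ∂μ = ∫⁻ t in Set.Ioi (0 : ℝ), μ {x | ENNReal.ofReal t < f x} := by
  have hg : ∀ g : Ω → ℝ≥0∞, Measurable g →
      ∫⁻ x, g x ∂μ = ∫⁻ t in Set.Ioi (0 : ℝ), μ {x | ENNReal.ofReal t < g x} := by
    intro g hg
    have hm : MeasurableSet {p : Ω × ℝ | ENNReal.ofReal p.2 < g p.1} :=
      measurableSet_lt (by fun_prop) (by fun_prop)
    calc ∫⁻ x, g x ∂μ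
        = ∫⁻ x, (∫⁻ t in Set.Ioi (0 : ℝ),
            {p : Ω × ℝ | ENNReal.ofReal p.2 < g p.1}.indicator 1 (x, t)) ∂μ := by
          refine lintegral_congr fun x => ?_
          rw [← lintegral_Ioi_indicator_lt (g x)]
          rfl
      _ = ∫⁻ t in Set.Ioi (0 : ℝ), ∫⁻ x,
            {p : Ω × ℝ | ENNReal.ofReal p.2 < g p.1}.indicator 1 (x, t) ∂μ := by
          apply lintegral_lintegral_swap
          exact (measurable_one.indicator hm).aemeasurable
      _ = _ := by
          refine lintegral_congr fun t => ?_
          rw [← lintegral_indicator_one (measurableSet_lt measurable_const hg)]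
          rfl
  rw [lintegral_congr_ae hf.ae_eq_mk, hg _ hf.measurable_mk]
  refine lintegral_congr fun t => measure_congr ?_
  filter_upwards [hf.ae_eq_mk] with x hx
  show (_ < _) = (_ < _)
  rw [hx]

/-- A path that is right-continuous, stays in the cemetery and stays in `T`. -/
structure IsRegularPath {Y : Type*} (T : Finset Y) (z : ℝ≥0 → Option Y) : Prop where
  right_continuous : ∀ t : ℝ≥0, ∀ᶠ s in 𝓝[>] t, z s = z t
  terminated : ∀ s t : ℝ≥0, s ≤ t → z s = none → z t = none
  absorbed : ∀ s t : ℝ≥0, s ≤ t → (∃ j ∈ T, z s = some j) → ∃ j ∈ T, z t = some j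

/-- The infimum is attained: just after t the path still has its value at t, and it has already met
`T` by then. -/
theorem absorptionTime_le_iff {Y Ω : Type*} {T : Finset Y} {Z : ℝ≥0 → Ω → Option Y} {x : Ω}
    (hx : IsRegularPath T fun t => Z t x) (t : ℝ≥0) :
    absorptionTime T Z x ≤ t ↔ ∃ j ∈ T, Z t x = some j := by
  refine ⟨fun h => ?_, fun h => iInf₂_le t h⟩
  obtain ⟨v, hv, hv'⟩ := mem_nhdsGT_iff_exists_Ioo_subset.1 (hx.right_continuous t)
  obtain ⟨s, hs1, hs2⟩ := exists_between (show t < v from hv)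
  have e : Z s x = Z t x := hv' ⟨hs1, hs2⟩
  have hlt : absorptionTime T Z x < s := h.trans_lt (ENNReal.coe_lt_coe.2 hs1)
  simp only [absorptionTime, iInf_lt_iff] at hlt
  obtain ⟨u, hu, hus⟩ := hlt
  have := hx.absorbed u s (ENNReal.coe_lt_coe.1 hus).le hu
  rwa [e] at this

theorem absorptionTime_eq_top {Y Ω : Type*} {T : Finset Y} {Z : ℝ≥0 → Ω → Option Y} {x : Ω}
    (hx : IsRegularPath T fun t => Z t x) {t : ℝ≥0}
    (ht : Z t x = none) : absorptionTime T Z x = ⊤ := by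
  simp only [absorptionTime, iInf_eq_top]
  intro s hs
  exfalso
  obtain ⟨j, _, hj⟩ := hx.absorbed s (max s t) (le_max_left _ _) hs
  have := hx.terminated t (max s t) (le_max_right _ _) ht
  rw [this] at hj
  cases hj

variable {Y : Type*} [Fintype Y] [DecidableEq Y] {Ω : Type*} [MeasurableSpace Ω]
  {G : Matrix Y Y ℝ} {P : Measure Ω} {Z : ℝ≥0 → Ω → Option Y} {T : Finset Y}

theorem measurableSet_mem_target (hZ : IsMarkovJumpProcess G P Z) (T : Finset Y) (t : ℝ≥0) :
    MeasurableSet {x | ∃ j ∈ T, Z t x = some j} := by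
  have : {x | ∃ j ∈ T, Z t x = some j} = ⋃ j ∈ T, Z t ⁻¹' {some j} := by
    ext x; simp
  rw [this]
  exact Finset.measurableSet_biUnion _ fun j _ => hZ.measurable t _

theorem measureReal_inter_mem_target [IsFiniteMeasure P] (hZ : IsMarkovJumpProcess G P Z)
    (T : Finset Y) (s t : ℝ≥0) (i : Y) :
    P.real (Z s ⁻¹' {some i} ∩ {x | ∃ j ∈ T, Z (s + t) x = some j}) =
      (∑ j ∈ T, transition G t j i) * P.real (Z s ⁻¹' {some i}) := by
  have : Z s ⁻¹' {some i} ∩ {x | ∃ j ∈ T, Z (s + t) x = some j} =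
      ⋃ j ∈ T, Z s ⁻¹' {some i} ∩ Z (s + t) ⁻¹' {some j} := by
    ext x; simp
  rw [this, measureReal_biUnion_finset, Finset.sum_mul]
  · exact Finset.sum_congr rfl fun j _ => hZ.transition_prob s t i j
  · intro j _ k _ hjk
    refine Set.disjoint_left.2 fun x hx hx' => hjk ?_
    have h1 : Z (s + t) x = some j := hx.2
    have h2 : Z (s + t) x = some k := hx'.2
    exact Option.some_injective _ (h1.symm.trans h2)
  · exact fun j _ => (hZ.measurable _ _).inter (hZ.measurable _ _)

theorem ae_absorbed_pair [IsFiniteMeasure P] (hZ : IsMarkovJumpProcess G P Z)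
    (hT : IsAbsorbing G T) (s t : ℝ≥0) :
    ∀ᵐ x ∂P, (∃ j ∈ T, Z s x = some j) → ∃ j ∈ T, Z (s + t) x = some j := by
  have key : ∀ i ∈ T, ∀ᵐ x ∂P, Z s x = some i → ∃ j ∈ T, Z (s + t) x = some j := by
    intro i hi
    have h1 := measureReal_inter_mem_target hZ T s t i
    rw [hT t i hi, one_mul] at h1
    have h2 := measureReal_inter_add_sdiff (μ := P) (s := Z s ⁻¹' {some i})
      (measurableSet_mem_target hZ T (s + t))
    rw [h1] at h2
    have h3 : P.real (Z s ⁻¹' {some i} \ {x | ∃ j ∈ T, Z (s + t) x = some j}) = 0 := by linarith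
    rw [measureReal_eq_zero_iff] at h3
    rw [ae_iff]
    refine measure_mono_null (fun x hx => ?_) h3
    simp only [Set.mem_ofPred_eq, Classical.not_imp] at hx
    exact hx
  filter_upwards [(ae_ball_iff T.countable_toSet).2 key] with x hx
  rintro ⟨i, hi, hxi⟩
  exact hx i hi hxi

/-- Absorption holds almost surely for each fixed pair of times, hence for all pairs from a
countable dense set at once; right-continuity extends it to all times. -/
theorem ae_isRegularPath [IsFiniteMeasure P] (hZ : IsMarkovJumpProcess G P Z)
    (hT : IsAbsorbing G T) : ∀ᵐ x ∂P, IsRegularPath T fun t => Z t x := by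
  obtain ⟨D, hDc, hD⟩ := TopologicalSpace.exists_countable_dense ℝ≥0
  have key : ∀ᵐ x ∂P, ∀ s ∈ D, ∀ t ∈ D, s ≤ t →
      (∃ j ∈ T, Z s x = some j) → ∃ j ∈ T, Z t x = some j := by
    refine (ae_ball_iff hDc).2 fun s _ => (ae_ball_iff hDc).2 fun t _ => ?_
    by_cases hst : s ≤ t
    · filter_upwards [ae_absorbed_pair hZ hT s (t - s)] with x hx _
      rwa [add_tsub_cancel_of_le hst] at hx
    · simp [hst]
  filter_upwards [key, hZ.terminated, hZ.right_continuous] with x h1 h2 h3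
  refine ⟨h3, h2, fun s t hst hs => ?_⟩
  rcases hst.eq_or_lt with rfl | hst
  · exact hs
  obtain ⟨u, hu, hu'⟩ := mem_nhdsGT_iff_exists_Ioo_subset.1 (h3 s)
  obtain ⟨v, hv, hv'⟩ := mem_nhdsGT_iff_exists_Ioo_subset.1 (h3 t)
  obtain ⟨s', hs'D, hs'1, hs'2⟩ := hD.exists_between (lt_min hu hst)
  obtain ⟨t', ht'D, ht'1, ht'2⟩ := hD.exists_between hv
  have e1 : Z s' x = Z s x := hu' ⟨hs'1, hs'2.trans_le (min_le_left _ _)⟩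
  have e2 : Z t' x = Z t x := hv' ⟨ht'1, ht'2⟩
  have := h1 s' hs'D t' ht'D ((hs'2.trans_le (min_le_right _ _)).trans ht'1).le (by rwa [e1])
  rwa [e2] at this

theorem aemeasurable_absorptionTime [IsFiniteMeasure P] (hZ : IsMarkovJumpProcess G P Z)
    (hT : IsAbsorbing G T) : AEMeasurable (absorptionTime T Z) P := by
  classical
  obtain ⟨D, hDc, hD⟩ := TopologicalSpace.exists_countable_dense ℝ≥0
  have := hDc.to_subtype
  refine ⟨fun x => ⨅ t : D, if ∃ j ∈ T, Z t x = some j then ((t : ℝ≥0) : ℝ≥0∞) else ⊤,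
    Measurable.iInf fun t => Measurable.ite (measurableSet_mem_target hZ T t) measurable_const
      measurable_const, ?_⟩
  filter_upwards [ae_isRegularPath hZ hT] with x hx
  apply le_antisymm
  · refine le_iInf fun t => ?_
    split_ifs with h
    · exact (absorptionTime_le_iff hx t).2 h
    · exact le_top
  · refine le_iInf₂ fun t ht => ?_
    refine ENNReal.le_of_forall_pos_le_add fun ε hε _ => ?_
    -- A path in `T` at time t is still there at a time of `D` within ε after t.
    obtain ⟨s, hsD, hs1, hs2⟩ := hD.exists_between (lt_add_of_pos_right t hε)
    refine (iInf_le _ ⟨s, hsD⟩).trans ?_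
    rw [if_pos (hx.absorbed t s hs1.le ht)]
    exact_mod_cast hs2.le

theorem cond_measureReal_mem [IsProbabilityMeasure P] (hZ : IsMarkovJumpProcess G P Z)
    (T : Finset Y) (t : ℝ≥0) {i : Y} (hi : P (Z 0 ⁻¹' {some i}) ≠ 0) :
    (P[|Z 0 ⁻¹' {some i}]).real {x | ∃ j ∈ T, Z t x = some j} = ∑ j ∈ T, transition G t j i := by
  have h := measureReal_inter_mem_target hZ T 0 t i
  rw [zero_add] at h
  have hne : P.real (Z 0 ⁻¹' {some i}) ≠ 0 := by
    rwa [Ne, measureReal_eq_zero_iff]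
  rw [measureReal_def, cond_apply (hZ.measurable 0 _), ENNReal.toReal_mul, ENNReal.toReal_inv,
    ← measureReal_def, ← measureReal_def, h]
  field_simp

theorem transition_nonneg [IsProbabilityMeasure P] (hZ : IsMarkovJumpProcess G P Z) {i : Y}
    (hi : P (Z 0 ⁻¹' {some i}) ≠ 0) (t : ℝ≥0) (j : Y) : 0 ≤ transition G t j i := by
  have := cond_measureReal_mem hZ {j} t hi
  rw [Finset.sum_singleton] at this
  rw [← this]
  exact measureReal_nonneg

theorem sum_transition_le_one [IsProbabilityMeasure P] (hZ : IsMarkovJumpProcess G P Z) {i : Y}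
    (hi : P (Z 0 ⁻¹' {some i}) ≠ 0) (t : ℝ≥0) : ∑ j, transition G t j i ≤ 1 := by
  have := cond_isProbabilityMeasure hi
  rw [← cond_measureReal_mem hZ Finset.univ t hi]
  exact measureReal_le_one

/-- A finite expectation would make A finite almost surely, but A = ∞ on every regular path that
terminates. -/
theorem expectedAbsorptionTime_eq_top [IsProbabilityMeasure P] (hZ : IsMarkovJumpProcess G P Z)
    (hT : IsAbsorbing G T) {i : Option Y} (t : ℝ≥0)
    (ht : (P[|Z 0 ⁻¹' {i}]) (Z t ⁻¹' {none}) ≠ 0) :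
    expectedAbsorptionTime T P Z i = ⊤ := by
  by_contra hne
  have hm := (aemeasurable_absorptionTime hZ hT).mono_ac
    (cond_absolutelyContinuous (s := Z 0 ⁻¹' {i}))
  have hfin := ae_lt_top' hm hne
  refine ht (measure_eq_zero_iff_ae_notMem.2 ?_)
  filter_upwards [hfin, cond_absolutelyContinuous.ae_le (ae_isRegularPath hZ hT)]
    with x h1 h2 h3
  exact h1.ne (absorptionTime_eq_top h2 h3)

theorem expectedAbsorptionTime_none [IsProbabilityMeasure P] (hZ : IsMarkovJumpProcess G P Z)
    (hT : IsAbsorbing G T) (hi : P (Z 0 ⁻¹' {none}) ≠ 0) :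
    expectedAbsorptionTime T P Z none = ⊤ := by
  refine expectedAbsorptionTime_eq_top hZ hT 0 ?_
  rw [cond_apply_self hi (measure_ne_top _ _)]
  exact one_ne_zero

theorem expectedAbsorptionTime_of_canTerminate [IsProbabilityMeasure P]
    (hZ : IsMarkovJumpProcess G P Z) (hT : IsAbsorbing G T) {i : Y}
    (hi : P (Z 0 ⁻¹' {some i}) ≠ 0) (h : CanTerminate G (some i)) :
    expectedAbsorptionTime T P Z (some i) = ⊤ := by
  obtain ⟨t, ht⟩ := h
  refine expectedAbsorptionTime_eq_top hZ hT t fun h0 => ht.ne ?_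
  have := cond_isProbabilityMeasure hi
  rw [← cond_measureReal_mem hZ Finset.univ t hi, measureReal_def]
  have : {x | ∃ j ∈ Finset.univ, Z t x = some j} = (Z t ⁻¹' {none})ᶜ := by
    ext x; simp [← Option.ne_none_iff_exists']
  rw [this, (prob_compl_eq_one_iff (hZ.measurable t none)).2 h0, ENNReal.toReal_one]

theorem expectedAbsorptionTime_target {i : Y} [IsProbabilityMeasure P]
    (hZ : IsMarkovJumpProcess G P Z) (hi : i ∈ T) :
    expectedAbsorptionTime T P Z (some i) = 0 := by
  rw [expectedAbsorptionTime]
  refine (lintegral_congr_ae ?_).trans lintegral_zero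
  filter_upwards [ae_cond_mem (hZ.measurable 0 (some i))] with x hx
  have hx' : Z 0 x = some i := hx
  exact le_antisymm ((iInf₂_le 0 ⟨i, hi, hx'⟩).trans (by simp)) zero_le

theorem expectedAbsorptionTime_some [IsProbabilityMeasure P]
    (hZ : IsMarkovJumpProcess G P Z) (hT : IsAbsorbing G T) {i : Y}
    (hi : P (Z 0 ⁻¹' {some i}) ≠ 0) :
    expectedAbsorptionTime T P Z (some i) =
      ∫⁻ t in Set.Ioi (0 : ℝ), ENNReal.ofReal (1 - ∑ j ∈ T, transition G t.toNNReal j i) := by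
  have := cond_isProbabilityMeasure hi
  have hm := (aemeasurable_absorptionTime hZ hT).mono_ac
    (cond_absolutelyContinuous (s := Z 0 ⁻¹' {some i}))
  rw [expectedAbsorptionTime, lintegral_eq_lintegral_Ioi_measure_lt _ hm]
  refine lintegral_congr fun t => ?_
  rw [← cond_measureReal_mem hZ T t.toNNReal hi,
    ← probReal_compl_eq_one_sub (measurableSet_mem_target hZ T _), ofReal_measureReal]
  refine measure_congr ?_
  filter_upwards [cond_absolutelyContinuous.ae_le (ae_isRegularPath hZ hT)] with x hx
  have h := absorptionTime_le_iff hx t.toNNReal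
  show (_ < _) = ¬ _
  rw [← not_le, eq_iff_iff]
  exact not_congr h

end

/-! ### Sums and products in the extended reals. -/

section
theorem ereal_sum_ne_bot {ι : Type*} (s : Finset ι) {f : ι → EReal} (hf : ∀ i ∈ s, f i ≠ ⊥) :
    ∑ i ∈ s, f i ≠ ⊥ := by
  classical
  induction s using Finset.induction_on with
  | empty => simp
  | insert i s hi ih =>
    rw [Finset.sum_insert hi, Ne, EReal.add_eq_bot_iff, not_or]
    exact ⟨hf i (by simp), ih fun j hj => hf j (by simp [hj])⟩

theorem ereal_sum_eq_top_iff {ι : Type*} (s : Finset ι) {f : ι → EReal}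
    (hf : ∀ i ∈ s, f i ≠ ⊥) : ∑ i ∈ s, f i = ⊤ ↔ ∃ i ∈ s, f i = ⊤ := by
  classical
  induction s using Finset.induction_on with
  | empty => simp
  | insert i s hi ih =>
    have h1 := hf i (by simp)
    have h2 : ∀ j ∈ s, f j ≠ ⊥ := fun j hj => hf j (by simp [hj])
    have h3 := EReal.add_ne_top_iff_ne_top₂ h1 (ereal_sum_ne_bot s h2)
    rw [Finset.sum_insert hi, Finset.exists_mem_insert, ← ih h2]
    tauto

theorem ereal_coe_sum {ι : Type*} (s : Finset ι) (f : ι → ℝ) :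
    ((∑ i ∈ s, f i : ℝ) : EReal) = ∑ i ∈ s, (f i : EReal) := by
  classical
  induction s using Finset.induction_on with
  | empty => simp
  | insert i s hi ih => rw [Finset.sum_insert hi, Finset.sum_insert hi, EReal.coe_add, ih]

theorem ereal_mul_coe_ne_bot {x : EReal} (hx : x ≠ ⊥) {c : ℝ} (hc : 0 ≤ c) :
    x * (c : EReal) ≠ ⊥ := by
  induction x with
  | bot => exact absurd rfl hx
  | coe x => rw [← EReal.coe_mul]; exact EReal.coe_ne_bot _
  | top =>
    rcases hc.eq_or_lt with rfl | hc
    · simp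
    · rw [EReal.top_mul_coe_of_pos hc]; simp

theorem ereal_mul_coe_eq_top_iff {x : EReal} {c : ℝ} (hx : x ≠ ⊥) (hc : 0 ≤ c) :
    x * (c : EReal) = ⊤ ↔ x = ⊤ ∧ 0 < c := by
  induction x with
  | bot => exact absurd rfl hx
  | coe x =>
    rw [← EReal.coe_mul]
    exact iff_of_false (EReal.coe_ne_top _) fun h => EReal.coe_ne_top _ h.1
  | top =>
    rcases hc.eq_or_lt with rfl | hc
    · simp
    · rw [EReal.top_mul_coe_of_pos hc]; simp [hc]

/-- One-sided derivatives on [0, ∞) are unique, so the endpoint 0 is covered as well. -/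
theorem hasDerivAt_eq_zero_of_eqOn_Ici {f : ℝ → ℝ} {c f' t : ℝ} (hf : ∀ s, 0 ≤ s → f s = c)
    (ht : 0 ≤ t) (hd : HasDerivAt f f' t) : f' = 0 := by
  have h1 : HasDerivWithinAt f 0 (Set.Ici 0) t :=
    (hasDerivWithinAt_const t (Set.Ici 0) c).congr (fun s hs => hf s hs) (hf t ht)
  exact (uniqueDiffOn_Ici (0 : ℝ) t ht).eq_deriv _ hd.hasDerivWithinAt h1

/-! ### Rates at absorbing, terminating and non-terminating states. -/

theorem terminationRate_nonneg {Y : Type*} [Fintype Y] {G : Matrix Y Y ℝ}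
    (hG : IsGenerator G) (i : Y) : 0 ≤ terminationRate G i :=
  neg_nonneg.2 (hG.col_sum_nonpos i)

variable {Y : Type*} [Fintype Y] [DecidableEq Y] {G : Matrix Y Y ℝ} {T : Finset Y}

/-- Differentiating at t = 0 shows that the rates into `T` sum to 0. The other entries of the column
are nonnegative with nonpositive sum. -/
theorem absorbing_columns (hG : IsGenerator G) (hT : IsAbsorbing G T) {i : Y} (hi : i ∈ T) :
    (∀ j ∉ T, G j i = 0) ∧ ∑ j, G j i = 0 := by
  have hd := hasDerivAt_vecMul_exp_smul G (fun j => if j ∈ T then (1 : ℝ) else 0) i 0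
  have h0 := hasDerivAt_eq_zero_of_eqOn_Ici (c := 1) (fun s hs => by
    have : ∑ j ∈ T, NormedSpace.exp (s • G) j i = 1 := hT ⟨s, hs⟩ i hi
    simpa [Matrix.vecMul, dotProduct] using this) le_rfl hd
  simp only [zero_smul, NormedSpace.exp_zero, Matrix.vecMul, dotProduct, ite_mul, one_mul,
    zero_mul, Finset.sum_ite_mem, Finset.univ_inter] at h0
  have h1 := hG.col_sum_nonpos i
  rw [← Finset.sum_add_sum_compl T, h0, zero_add] at h1
  have hnn : ∀ j ∈ Tᶜ, 0 ≤ G j i := fun j hj =>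
    hG.off_diag_nonneg j i fun e => Finset.mem_compl.1 hj (e ▸ hi)
  have h2 := le_antisymm h1 (Finset.sum_nonneg hnn)
  refine ⟨fun j hj => (Finset.sum_eq_zero_iff_of_nonneg hnn).1 h2 j (Finset.mem_compl.2 hj), ?_⟩
  rw [← Finset.sum_add_sum_compl T, h0, h2, add_zero]

theorem hasDerivAt_sum_exp_smul (G : Matrix Y Y ℝ) (i : Y) (t : ℝ) :
    HasDerivAt (fun s : ℝ => ∑ j, NormedSpace.exp (s • G) j i)
      (∑ k, (∑ j, NormedSpace.exp (t • G) j k) * G k i) t := by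
  have h := hasDerivAt_vecMul_exp_smul G (fun _ => (1 : ℝ)) i t
  rw [← Matrix.vecMul_vecMul] at h
  simpa only [Matrix.vecMul, dotProduct, one_mul] using h

theorem sum_exp_zero_smul (G : Matrix Y Y ℝ) (i : Y) :
    ∑ j, NormedSpace.exp ((0 : ℝ) • G) j i = 1 := by
  simp [Matrix.one_apply]

theorem not_canTerminate_iff (hsub : ∀ (t : ℝ≥0) i, ∑ j, transition G t j i ≤ 1) (i : Y) :
    ¬ CanTerminate G (some i) ↔ ∀ t : ℝ, 0 ≤ t → ∑ j, NormedSpace.exp (t • G) j i = 1 := by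
  simp only [CanTerminate, not_exists, not_lt]
  exact ⟨fun h t ht => le_antisymm (hsub ⟨t, ht⟩ i) (h ⟨t, ht⟩), fun h t => (h t t.2).ge⟩

/-- Let S_k(t) be the k-th column sum of e^{tG}. If both alternatives fail, S_i' = ∑ (S_k - 1)
G_{ki} has only nonnegative terms: for k = i both factors are nonpositive, and for a successor k the
first is 0. So S_i never drops below S_i(0) = 1. -/
theorem CanTerminate.rate_pos_or_exists (hG : IsGenerator G)
    (hsub : ∀ (t : ℝ≥0) i, ∑ j, transition G t j i ≤ 1) {i : Y}
    (h : CanTerminate G (some i)) :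
    0 < terminationRate G i ∨ ∃ j, j ≠ i ∧ 0 < G j i ∧ CanTerminate G (some j) := by
  by_contra! hcon
  obtain ⟨hr, hj⟩ := hcon
  have hr0 : ∑ j, G j i = 0 := neg_eq_zero.1 (le_antisymm hr (terminationRate_nonneg hG i))
  have hii : G i i ≤ 0 := by
    have := Finset.sum_nonneg fun j (hj : j ∈ Finset.univ.erase i) =>
      hG.off_diag_nonneg j i (Finset.ne_of_mem_erase hj)
    rw [← Finset.add_sum_erase _ _ (Finset.mem_univ i)] at hr0
    linarith
  have hmono : MonotoneOn (fun s : ℝ => ∑ j, NormedSpace.exp (s • G) j i) (Set.Ici 0) := by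
    refine monotoneOn_of_deriv_nonneg (convex_Ici 0)
      (fun t _ => (hasDerivAt_sum_exp_smul G i t).continuousAt.continuousWithinAt)
      (fun t _ => (hasDerivAt_sum_exp_smul G i t).differentiableAt.differentiableWithinAt) ?_
    intro t ht
    rw [interior_Ici] at ht
    have ht0 : (0 : ℝ) ≤ t := le_of_lt ht
    rw [(hasDerivAt_sum_exp_smul G i t).deriv]
    have e : ∑ k, (∑ j, NormedSpace.exp (t • G) j k) * G k i =
        ∑ k, ((∑ j, NormedSpace.exp (t • G) j k) - 1) * G k i := by
      simp only [sub_mul, one_mul, Finset.sum_sub_distrib, hr0, sub_zero]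
    rw [e]
    refine Finset.sum_nonneg fun k _ => ?_
    have hk : ∑ j, NormedSpace.exp (t • G) j k ≤ 1 := hsub ⟨t, ht0⟩ k
    by_cases hki : k = i
    · subst hki
      exact mul_nonneg_of_nonpos_of_nonpos (by linarith) hii
    · rcases (hG.off_diag_nonneg k i hki).eq_or_lt with h0 | h0
      · rw [← h0, mul_zero]
      · rw [(not_canTerminate_iff hsub k).1 (hj k hki h0) t ht0, sub_self, zero_mul]
  obtain ⟨t, ht⟩ := h
  have := hmono (Set.mem_Ici.2 le_rfl) (Set.mem_Ici.2 t.2) t.2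
  simp only [sum_exp_zero_smul] at this
  exact absurd ht (not_lt.2 this)

/-- The column sum at i is constantly 1, so its derivative vanishes. This equates a sum of
nonnegative terms with minus the termination rate, and everything is 0. -/
theorem rate_eq_zero_of_not_canTerminate (hG : IsGenerator G)
    (hsub : ∀ (t : ℝ≥0) i, ∑ j, transition G t j i ≤ 1) {i : Y}
    (h : ¬ CanTerminate G (some i)) :
    terminationRate G i = 0 ∧ ∀ j, j ≠ i → 0 < G j i → ¬ CanTerminate G (some j) := by
  rw [not_canTerminate_iff hsub] at h
  have key : ∀ t : ℝ, 0 ≤ t → terminationRate G i = 0 ∧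
      ∀ k, (1 - ∑ j, NormedSpace.exp (t • G) j k) * G k i = 0 := by
    intro t ht
    have h0 := hasDerivAt_eq_zero_of_eqOn_Ici h ht (hasDerivAt_sum_exp_smul G i t)
    have e : ∑ k, (1 - ∑ j, NormedSpace.exp (t • G) j k) * G k i = -terminationRate G i := by
      simp only [sub_mul, one_mul, Finset.sum_sub_distrib, h0, sub_zero, terminationRate, neg_neg]
    have hnn : ∀ k ∈ Finset.univ, 0 ≤ (1 - ∑ j, NormedSpace.exp (t • G) j k) * G k i := by
      intro k _
      by_cases hki : k = i
      · rw [hki, h t ht, sub_self, zero_mul]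
      · exact mul_nonneg (sub_nonneg.2 (hsub ⟨t, ht⟩ k)) (hG.off_diag_nonneg k i hki)
    have hs := Finset.sum_nonneg hnn
    have hr := terminationRate_nonneg hG i
    have hr0 : terminationRate G i = 0 := by linarith
    rw [hr0, neg_zero] at e
    exact ⟨hr0, fun k => (Finset.sum_eq_zero_iff_of_nonneg hnn).1 e k (Finset.mem_univ k)⟩
  refine ⟨(key 0 le_rfl).1, fun j _ hj => (not_canTerminate_iff hsub j).2 fun t ht => ?_⟩
  have := (mul_eq_zero.1 ((key t ht).2 j)).resolve_right hj.ne'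
  linarith

/-- The equation at a state off the target with finite coefficients, in real numbers. -/
theorem sum_erase_add_one_eq_iff (x : Y → ℝ) {i : Y} (hi : i ∉ T) :
    ∑ j ∈ Tᶜ.erase i, x j * G j i + 1 = -G i i * x i ↔
      Matrix.vecMul (fun j : {j // j ∉ T} => x j) (restrictedGenerator G T) ⟨i, hi⟩ = -1 := by
  have h1 : Matrix.vecMul (fun j : {j // j ∉ T} => x j) (restrictedGenerator G T) ⟨i, hi⟩ =
      ∑ j ∈ Tᶜ, x j * G j i := by
    rw [Finset.sum_subtype Tᶜ (p := fun j => j ∉ T) (fun j => Finset.mem_compl)]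
    rfl
  rw [h1, ← Finset.add_sum_erase _ _ (Finset.mem_compl.2 hi)]
  constructor <;> intro h <;> linarith

theorem off_target_lhs_eq_coe {a : Option Y → EReal} (hbot : ∀ i, a i ≠ ⊥) {i : Y}
    (hr : terminationRate G i = 0) (hfin : ∀ j ∉ T, j ≠ i → a (some j) = ⊤ → G j i = 0) :
    (∑ j ∈ Tᶜ.erase i, a (some j) * (G j i : EReal)) +
        a none * (terminationRate G i : EReal) + 1 =
      ((∑ j ∈ Tᶜ.erase i, (a (some j)).toReal * G j i + 1 : ℝ) : EReal) := by
  rw [hr, EReal.coe_zero, mul_zero, add_zero, EReal.coe_add, ereal_coe_sum, EReal.coe_one]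
  congr 1
  refine Finset.sum_congr rfl fun j hj => ?_
  rw [Finset.mem_erase, Finset.mem_compl] at hj
  -- `toReal` sends `⊤` to 0, which is harmless because the coefficient is 0 there.
  by_cases htop : a (some j) = ⊤
  · rw [hfin j hj.2 hj.1 htop]; simp
  · rw [EReal.coe_mul, EReal.coe_toReal htop (hbot _)]

theorem off_target_lhs_eq_top_iff (hG : IsGenerator G) {a : Option Y → EReal}
    (hbot : ∀ i, a i ≠ ⊥) (hnone : a none = ⊤) (i : Y) :
    (∑ j ∈ Tᶜ.erase i, a (some j) * (G j i : EReal)) +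
        a none * (terminationRate G i : EReal) + 1 = ⊤ ↔
      0 < terminationRate G i ∨ ∃ j ∉ T, j ≠ i ∧ 0 < G j i ∧ a (some j) = ⊤ := by
  have hr := terminationRate_nonneg hG i
  have hterm : ∀ j ∈ Tᶜ.erase i, a (some j) * (G j i : EReal) ≠ ⊥ := fun j hj =>
    ereal_mul_coe_ne_bot (hbot _) (hG.off_diag_nonneg j i (Finset.ne_of_mem_erase hj))
  have hsum := ereal_sum_ne_bot _ hterm
  have hnb := ereal_mul_coe_ne_bot (hbot none) hr
  have h1 : (∑ j ∈ Tᶜ.erase i, a (some j) * (G j i : EReal)) = ⊤ ↔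
      ∃ j ∉ T, j ≠ i ∧ 0 < G j i ∧ a (some j) = ⊤ := by
    rw [ereal_sum_eq_top_iff _ hterm]
    refine exists_congr fun j => ?_
    constructor
    · rintro ⟨hj, h⟩
      rw [Finset.mem_erase, Finset.mem_compl] at hj
      rw [ereal_mul_coe_eq_top_iff (hbot _) (hG.off_diag_nonneg j i hj.1)] at h
      exact ⟨hj.2, hj.1, h.2, h.1⟩
    · rintro ⟨hj, hji, h, h'⟩
      exact ⟨by simp [hj, hji], (ereal_mul_coe_eq_top_iff (hbot _) h.le).2 ⟨h', h⟩⟩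
  have h2 : a none * (terminationRate G i : EReal) = ⊤ ↔ 0 < terminationRate G i := by
    rw [ereal_mul_coe_eq_top_iff (hbot _) hr]; simp [hnone]
  have h3 := EReal.add_ne_top_iff_ne_top₂ hsum hnb
  have h4 := EReal.add_ne_top_iff_ne_top₂ (y := 1)
    (fun h => (EReal.add_eq_bot_iff.1 h).elim hsum hnb) (EReal.coe_ne_bot 1)
  have h5 : (1 : EReal) ≠ ⊤ := EReal.coe_ne_top 1
  rw [← h1, ← h2]
  tauto

/-- What the equation of a solution says at a state off the target with a finite value. -/
theorem SolvesSystem.of_ne_top (hG : IsGenerator G) {b : Option Y → EReal}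
    (hb : SolvesSystem G T b) {i : Y} (hi : i ∉ T) (hbi : b (some i) ≠ ⊤) :
    terminationRate G i = 0 ∧ (∀ j ∉ T, j ≠ i → b (some j) = ⊤ → G j i = 0) ∧
      Matrix.vecMul (fun j : {j // j ∉ T} => (b (some j)).toReal) (restrictedGenerator G T)
        ⟨i, hi⟩ = -1 := by
  have heq := hb.off_target i hi
  rw [← EReal.coe_toReal hbi (hb.ne_bot _), ← EReal.coe_mul] at heq
  have hne := heq.trans_ne (EReal.coe_ne_top _)
  rw [Ne, off_target_lhs_eq_top_iff hG hb.ne_bot hb.cemetery] at hne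
  push Not at hne
  have hr := le_antisymm hne.1 (terminationRate_nonneg hG i)
  have hfin : ∀ j ∉ T, j ≠ i → b (some j) = ⊤ → G j i = 0 := fun j hj hji htop =>
    le_antisymm (not_lt.1 fun h => hne.2 j hj hji h htop) (hG.off_diag_nonneg j i hji)
  refine ⟨hr, hfin, (sum_erase_add_one_eq_iff (fun j => (b (some j)).toReal) hi).1 ?_⟩
  rw [off_target_lhs_eq_coe hb.ne_bot hr hfin] at heq
  exact EReal.coe_injective heq

/-- The finite states, including `T`, are closed under jumps and their columns sum to 0, so e^{tG}
preserves the all-ones row there. -/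
theorem SolvesSystem.not_canTerminate (hG : IsGenerator G) (hT : IsAbsorbing G T)
    {b : Option Y → EReal} (hb : SolvesSystem G T b) {i : Y} (hbi : b (some i) ≠ ⊤) :
    ¬ CanTerminate G (some i) := by
  rintro ⟨t, ht⟩
  have h := vecMul_exp_smul_of_closed G (fun j => b (some j) ≠ ⊤) (fun j k hj hk => by
      rw [not_not] at hj
      have hjT : j ∉ T := fun h => by simp [hb.target j h] at hj
      by_cases hkT : k ∈ T
      · exact (absorbing_columns hG hT hkT).1 j hjT
      · exact (hb.of_ne_top hG hkT hk).2.1 j hjT (fun e => hk (e ▸ hj)) hj)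
    (fun _ => 1) (fun k hk => by
      simp only [Matrix.vecMul, dotProduct, one_mul]
      by_cases hkT : k ∈ T
      · exact (absorbing_columns hG hT hkT).2
      · exact neg_eq_zero.1 (hb.of_ne_top hG hkT hk).1) t i hbi
  simp only [Matrix.vecMul, dotProduct, one_mul] at h
  exact ht.ne h

theorem SolvesSystem.eq_of_ne_top (hG : IsGenerator G)
    (htrans : Tendsto (fun t : ℝ => NormedSpace.exp (t • restrictedGenerator G T)) atTop (𝓝 0))
    {w : {j // j ∉ T} → ℝ} (hw : ∀ i, Matrix.vecMul w (restrictedGenerator G T) i = -1)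
    {b : Option Y → EReal} (hb : SolvesSystem G T b) {i : Y} (hi : i ∉ T)
    (hbi : b (some i) ≠ ⊤) : b (some i) = (w ⟨i, hi⟩ : EReal) := by
  have h := eq_zero_of_vecMul_eq_zero_of_closed htrans (fun j => b (some (j : Y)) ≠ ⊤)
    (fun j k hj hk => by
      rw [not_not] at hj
      exact (hb.of_ne_top hG k.2 hk).2.1 j j.2 (fun e => hk (e ▸ hj)) hj)
    ((fun j : {j // j ∉ T} => (b (some j)).toReal) - w) (fun k hk => by
      rw [Matrix.sub_vecMul, Pi.sub_apply, hw, (hb.of_ne_top hG k.2 hk).2.2, sub_self])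
    ⟨i, hi⟩ hbi
  rw [Pi.sub_apply, sub_eq_zero] at h
  rw [← h, EReal.coe_toReal hbi (hb.ne_bot _)]

/-- The ability to terminate spreads backwards along jumps just as the value ∞ does: both sides are
∞ where termination is possible, and elsewhere only finite values enter and w Ĝ = -1 applies. -/
theorem solvesSystem_of_eq (hG : IsGenerator G)
    (hsub : ∀ (t : ℝ≥0) i, ∑ j, transition G t j i ≤ 1)
    {w : {j // j ∉ T} → ℝ} (hw : ∀ i, Matrix.vecMul w (restrictedGenerator G T) i = -1)
    {a : Option Y → EReal} (hnone : a none = ⊤) (htarget : ∀ i ∈ T, a (some i) = 0)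
    (htop : ∀ i, CanTerminate G (some i) → a (some i) = ⊤)
    (hfin : ∀ i (hi : i ∉ T), ¬ CanTerminate G (some i) → a (some i) = (w ⟨i, hi⟩ : EReal)) :
    SolvesSystem G T a := by
  have hbot : ∀ i, a i ≠ ⊥ := by
    rintro (_ | i)
    · simp [hnone]
    · by_cases hi : i ∈ T
      · simp [htarget i hi]
      · by_cases hc : CanTerminate G (some i)
        · simp [htop i hc]
        · simp [hfin i hi hc]
  refine ⟨hbot, fun i hi => ?_, htarget, hnone⟩
  by_cases hc : CanTerminate G (some i)
  · have hneg : 0 < -G i i := by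
      by_contra hcon
      have hcol : ∀ j, G j i = 0 := by
        have h1 := hG.col_sum_nonpos i
        rw [← Finset.add_sum_erase _ _ (Finset.mem_univ i)] at h1
        have hnn : ∀ j ∈ Finset.univ.erase i, 0 ≤ G j i := fun j hj =>
          hG.off_diag_nonneg j i (Finset.ne_of_mem_erase hj)
        have h2 := Finset.sum_nonneg hnn
        have h3 : ∑ j ∈ Finset.univ.erase i, G j i = 0 := by linarith
        intro j
        by_cases hji : j = i
        · subst hji; linarith
        · exact (Finset.sum_eq_zero_iff_of_nonneg hnn).1 h3 j (by simp [hji])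
      have := hw ⟨i, hi⟩
      simp [Matrix.vecMul, dotProduct, restrictedGenerator, hcol] at this
    rw [htop i hc, EReal.coe_mul_top_of_pos hneg, off_target_lhs_eq_top_iff hG hbot hnone]
    refine (hc.rate_pos_or_exists hG hsub).imp id ?_
    rintro ⟨j, hji, hpos, hcj⟩
    refine ⟨j, fun hj => ?_, hji, hpos, htop j hcj⟩
    have := (htarget j hj).symm.trans (htop j hcj)
    simp at this
  · obtain ⟨hr, hn⟩ := rate_eq_zero_of_not_canTerminate hG hsub hc
    have hn' : ∀ j, j ≠ i → G j i ≠ 0 → ¬ CanTerminate G (some j) := fun j hji h =>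
      hn j hji ((hG.off_diag_nonneg j i hji).lt_of_ne' h)
    rw [off_target_lhs_eq_coe hbot hr, hfin i hi hc, ← EReal.coe_mul, EReal.coe_eq_coe_iff]
    · have e := (sum_erase_add_one_eq_iff (G := G)
        (fun j => if hj : j ∉ T then w ⟨j, hj⟩ else 0) hi).2 (by
          have hext : (fun j : {j // j ∉ T} => if hj : (j : Y) ∉ T then w ⟨j, hj⟩ else 0) = w :=
            funext fun j => dif_pos j.2
          rw [hext, hw])
      rw [dif_pos hi] at e
      rw [← e]
      congr 1
      refine Finset.sum_congr rfl fun j hj => ?_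
      rw [Finset.mem_erase, Finset.mem_compl] at hj
      by_cases h0 : G j i = 0
      · rw [h0, mul_zero, mul_zero]
      · rw [hfin j hj.2 (hn' j hj.1 h0), EReal.toReal_coe, dif_pos hj.2]
    · intro j hj hji hjtop
      by_contra h0
      rw [hfin j hj (hn' j hji h0)] at hjtop
      simp at hjtop

/-- Without termination, the probability of not being in `T` is the column sum of e^{tG} off `T`. As
nothing leaves `T`, that block of e^{tG} is e^{tĜ}. -/
theorem expectedAbsorptionTime_of_not_canTerminate {Ω : Type*} [MeasurableSpace Ω]
    (hG : IsGenerator G) (hT : IsAbsorbing G T)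
    (htrans : Tendsto (fun t : ℝ => NormedSpace.exp (t • restrictedGenerator G T)) atTop (𝓝 0))
    (hsub : ∀ (t : ℝ≥0) i, ∑ j, transition G t j i ≤ 1)
    {w : {j // j ∉ T} → ℝ} (hw : ∀ i, Matrix.vecMul w (restrictedGenerator G T) i = -1)
    {P : Measure Ω} [IsProbabilityMeasure P] {Z : ℝ≥0 → Ω → Option Y}
    (hZ : IsMarkovJumpProcess G P Z) {i : Y} (hstart : P (Z 0 ⁻¹' {some i}) ≠ 0) (hi : i ∉ T)
    (hc : ¬ CanTerminate G (some i)) :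
    (expectedAbsorptionTime T P Z (some i) : EReal) = (w ⟨i, hi⟩ : EReal) := by
  have hexp : ∀ (t : ℝ) (j : {j // j ∉ T}), NormedSpace.exp (t • G) j i =
      NormedSpace.exp (t • restrictedGenerator G T) j ⟨i, hi⟩ := fun t j =>
    exp_smul_submatrix_of_rows G (fun j => j ∉ T)
      (fun j k hj hk => (absorbing_columns hG hT (not_not.1 hk)).1 j hj) t j ⟨i, hi⟩
  obtain ⟨hw0, hint⟩ := lintegral_sum_exp_smul htrans hw ⟨i, hi⟩ fun t ht j => by
    rw [← hexp]
    exact transition_nonneg hZ hstart ⟨t, ht.le⟩ j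
  have hE : expectedAbsorptionTime T P Z (some i) = ENNReal.ofReal (w ⟨i, hi⟩) := by
    rw [expectedAbsorptionTime_some hZ hT hstart, ← hint]
    refine setLIntegral_congr_fun measurableSet_Ioi fun t ht => ?_
    have ht0 : (0 : ℝ) ≤ t := le_of_lt ht
    have h1 := (not_canTerminate_iff hsub i).1 hc t ht0
    rw [← Finset.sum_add_sum_compl T,
      Finset.sum_subtype Tᶜ (p := fun j => j ∉ T) (fun j => Finset.mem_compl)] at h1
    simp only [transition, Real.coe_toNNReal t ht0, ← hexp]
    congr 1
    linarith
  rw [hE, EReal.coe_ennreal_ofReal, max_eq_left hw0]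

end

end JumpProcess

theorem mainTheorem2 {Y : Type*} [Fintype Y] [DecidableEq Y]
    (G : Matrix Y Y ℝ) (hG : JumpProcess.IsGenerator G)
    (T : Finset Y) (hT : JumpProcess.IsAbsorbing G T)
    (htrans : Filter.Tendsto
      (fun t : ℝ => NormedSpace.exp (t • JumpProcess.restrictedGenerator G T))
      Filter.atTop (nhds 0))
    {Ω : Option Y → Type*} [∀ i, MeasurableSpace (Ω i)]
    (P : ∀ i, MeasureTheory.Measure (Ω i)) [∀ i, MeasureTheory.IsProbabilityMeasure (P i)]
    (Z : ∀ i, NNReal → Ω i → Option Y)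
    (hZ : ∀ i, JumpProcess.IsMarkovJumpProcess G (P i) (Z i))
    (hstart : ∀ i, P i (Z i 0 ⁻¹' {i}) ≠ 0)
    (a : Option Y → EReal)
    (ha : ∀ i, a i = (JumpProcess.expectedAbsorptionTime T (P i) (Z i) i : EReal)) :
    (JumpProcess.SolvesSystem G T a ∧ ∀ i, a i = ⊤ → JumpProcess.CanTerminate G i) ∧
    (∀ b : Option Y → EReal, JumpProcess.SolvesSystem G T b →
      (∀ i, b i = ⊤ → JumpProcess.CanTerminate G i) → b = a) ∧
    (∀ b : Option Y → EReal, JumpProcess.SolvesSystem G T b →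
      ∀ i, b i ≠ ⊤ → b i = a i) := by
  classical
  -- The bound is read off the processes, one started in each state.
  have hsub : ∀ (t : NNReal) i, ∑ j, JumpProcess.transition G t j i ≤ 1 := fun t i =>
    JumpProcess.sum_transition_le_one (hZ (some i)) (hstart (some i)) t
  obtain ⟨w, hw⟩ := JumpProcess.exists_vecMul_eq_neg_one htrans
  have hnone : a none = ⊤ := by
    rw [ha, JumpProcess.expectedAbsorptionTime_none (hZ none) hT (hstart none)]
    rfl
  have htarget : ∀ i ∈ T, a (some i) = 0 := fun i hi => by
    rw [ha, JumpProcess.expectedAbsorptionTime_target (hZ (some i)) hi]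
    rfl
  have htop : ∀ i, JumpProcess.CanTerminate G (some i) → a (some i) = ⊤ := fun i hc => by
    rw [ha, JumpProcess.expectedAbsorptionTime_of_canTerminate (hZ (some i)) hT
      (hstart (some i)) hc]
    rfl
  have hfin : ∀ i (hi : i ∉ T), ¬ JumpProcess.CanTerminate G (some i) →
      a (some i) = (w ⟨i, hi⟩ : EReal) := fun i hi hc => by
    rw [ha]
    exact JumpProcess.expectedAbsorptionTime_of_not_canTerminate hG hT htrans hsub hw
      (hZ (some i)) (hstart (some i)) hi hc
  have hterm : ∀ i, a i = ⊤ → JumpProcess.CanTerminate G i := by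
    rintro (_ | i) hi
    · trivial
    · by_contra hc
      by_cases hiT : i ∈ T
      · simp [htarget i hiT] at hi
      · simp [hfin i hiT hc] at hi
  have hagree : ∀ b : Option Y → EReal, JumpProcess.SolvesSystem G T b →
      ∀ i, b i ≠ ⊤ → b i = a i := by
    rintro b hb (_ | i) hbi
    · exact absurd hb.cemetery hbi
    · by_cases hiT : i ∈ T
      · rw [hb.target i hiT, htarget i hiT]
      · rw [hb.eq_of_ne_top hG htrans hw hiT hbi, hfin i hiT (hb.not_canTerminate hG hT hbi)]
  refine ⟨⟨JumpProcess.solvesSystem_of_eq hG hsub hw hnone htarget htop hfin, hterm⟩,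
    fun b hb hbterm => funext fun i => ?_, hagree⟩
  by_cases hbi : b i = ⊤
  · rw [hbi]
    rcases i with _ | i
    · exact hnone.symm
    · exact (htop i (hbterm _ hbi)).symm
  · exact hagree b hb i hbi
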